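/- Let $T>0$, let $U\subset\mathbb{R}^{d_1}$ be closed with $0\in U$, let $(\Omega,\mathcal F,\mathbb P)$ be a complete probability space carrying an $m$-dimensional standard Brownian motion $B=\{B_t\}_{0\le t\le T}$ and an independent $\mathbb{R}^d$-valued random variable $X_0$ with $\mathbb{E}|X_0|^2<\infty$, and let $\{\mathcal F_t\}$ be the augmented filtration generated by $B$ and $X_0$. Let $\mathcal U$ be the set of $U$-valued, jointly measurable, $\{\mathcal F_t\}$-adapted processes $u$ with $\mathbb{E}\int_0^T|u_t|^2dt<\infty$. Let $b:[0,T]\times\mathbb{R}^d\times U\to\mathbb{R}^d$ and $\sigma:[0,T]\times\mathbb{R}^d\times U\to\mathbb{R}^{d\times m}$ be Borel measurable and satisfy (A1) there are a constant $C_0>0$ and a function $\rho:[0,\infty)\to[0,\infty)$ with $\rho(r)\to\rho(0)=0$ as $r\to0$ such that, for $\varphi=b,\sigma$ and all $t,x,x',u,u'$, $$|\varphi(t,x,u)-\varphi(t,x',u')|\le C_0|x-x'|+\rho(|u-u'|),\qquad |\varphi(t,0,0)|\le C_0 .$$ For $u\in\mathcal U$ let $X^u$ be the continuous adapted solution of $$dX^u_t=b(t,X^u_t,u_t)\,dt+\sigma(t,X^u_t,u_t)\,dB_t,\qquad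 X^u_0=X_0,\qquad \mathbb{E}\Big[\sup_{0\le t\le T}|X^u_t|^2\Big]<\infty .$$ For Borel functions $f:[0,T]\times\mathbb{R}^d\times U\to\mathbb{R}$ and $g:\mathbb{R}^d\to\mathbb{R}$ put $$J(u;f,g)=\mathbb{E}\Big[\int_0^Tf(t,X^u_t,u_t)\,dt+g(X^u_T)\Big],\qquad J^*(f,g)=\inf_{u\in\mathcal U}J(u;f,g),$$ and, for a family $\mu=\{\mu_t\}_{0\le t\le T}$ of probability measures on $\mathbb{R}^d\times U$ with $\tilde\mu_T(dx)=\mu_T(dx\times U)$, $$V(f,g)=\int_0^T\!\int_{\mathbb{R}^d\times U} f(t,x,u)\,\mu_t(dx\,du)\,dt+\int_{\mathbb{R}^d} g\,d\tilde\mu_T-J^*(f,g).$$ All integrals and sums here are extended-real: an integral, including the double integral in $V$, is the integral of the positive part minus that of the negative part, and $\infty-\infty$ is read as $+\infty$; a control for which no solution $X^u$ exists has cost $J=+\infty$. Let $\mathcal D$ be a set of pairs $(f,g)$ of such Borel functions, let $(f^*,g^*)\in\mathcal D$, and let $u^*\in\mathcal U$ be optimal for $(f^*,g^*)$, that is, $J(u^*;f^*,g^*)=J^*(f^*,g^*)$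 is finite. Suppose that $\mu_t$ is the law of $(X^{u^*}_t,u^*_t)$ for each $t\in[0,T]$, and that $\int_0^T\!\int|f^*|\,d\mu_t\,dt<\infty$ and $\int|g^*|\,d\tilde\mu_T<\infty$. Then $(f^*,g^*)$ minimizes $V$ over $\mathcal D$, and $$V(f^*,g^*)=\inf_{(f,g)\in\mathcal D}V(f,g)=0 .$$ -/

import Mathlib

open MeasureTheory ProbabilityTheory Filter Topology
open scoped ENNReal NNReal

namespace InverseControl

noncomputable section

/-- The Euclidean space `ℝⁿ`. -/
abbrev Rn (n : ℕ) : Type := EuclideanSpace ℝ (Fin n)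

/-- The time interval `[0, T]`. -/
abbrev TimeInterval (T : ℝ≥0) : Type := Set.Icc (0 : ℝ) (T : ℝ)

/-- Lebesgue measure on `[0, T]`. -/
def timeMeasure (T : ℝ≥0) : Measure (TimeInterval T) :=
  (volume : Measure ℝ).comap Subtype.val

/-- The initial time, as an element of `[0, T]`. -/
def initialTime (T : ℝ≥0) : TimeInterval T := ⟨0, le_rfl, T.2⟩

/-- The terminal time `T`, as an element of `[0, T]`. -/
def terminalTime (T : ℝ≥0) : TimeInterval T := ⟨(T : ℝ), T.2, le_rfl⟩

/-! ### Extended-real integrals -/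

/-- Addition of extended reals with the convention `∞ - ∞ = +∞`. It is the usual addition
in all other cases. -/
def upperAdd (a b : EReal) : EReal := -(-a + -b)

/-- The integral of an extended-real function: the integral of the positive part minus the
integral of the negative part, with the convention `∞ - ∞ = +∞`. -/
def extIntegral {α : Type*} [MeasurableSpace α] (ν : Measure α) (h : α → EReal) : EReal :=
  upperAdd ((∫⁻ a, (h a).toENNReal ∂ν : ℝ≥0∞) : EReal)
    (-((∫⁻ a, (-h a).toENNReal ∂ν : ℝ≥0∞) : EReal))

/-! ### The driving noise and its filtration -/

section Noise

variable {Ω : Type*} [MeasurableSpace Ω]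

/-- `B` is an `m`-dimensional standard Brownian motion on `[0, T]` under `P`. -/
structure IsStandardBrownian {T : ℝ≥0} {m : ℕ} (B : TimeInterval T → Ω → Rn m)
    (P : Measure Ω) : Prop where
  measurable : ∀ t, Measurable (B t)
  zero : ∀ᵐ ω ∂P, B (initialTime T) ω = 0
  indep_increments : HasIndepIncrements B P
  law_increments : ∀ s t : TimeInterval T, s ≤ t →
    HasLaw (fun ω => B t ω - B s ω)
      (multivariateGaussian 0 (((t : ℝ) - (s : ℝ)) • (1 : Matrix (Fin m) (Fin m) ℝ))) P
  continuous_paths : ∀ᵐ ω ∂P, Continuous fun t => B t ω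

/-- The random inputs of the control problem: a standard Brownian motion `B` on `[0, T]` and an
independent square integrable initial state `X₀`. -/
structure Noise (T : ℝ≥0) (d m : ℕ) (P : Measure Ω) where
  /-- the Brownian motion -/
  B : TimeInterval T → Ω → Rn m
  /-- the initial state -/
  X₀ : Ω → Rn d
  brownian : IsStandardBrownian B P
  measurable_X₀ : Measurable X₀
  sq_integrable_X₀ : MemLp X₀ 2 P
  indep : IndepFun X₀ (fun ω t => B t ω) P

variable {T : ℝ≥0} {d d₁ m : ℕ} {P : Measure Ω}

/-- The augmented filtration: `ℱ_t` is generated by `X₀`, by `B_s` for `s ≤ t`, and by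
the `P`-null sets. -/
def Noise.filtration [hP : P.IsComplete] (N : Noise T d m P) :
    Filtration (TimeInterval T) (inferInstance : MeasurableSpace Ω) where
  seq t := (MeasurableSpace.comap N.X₀ inferInstance ⊔
      ⨆ s : TimeInterval T, ⨆ _ : s ≤ t, MeasurableSpace.comap (N.B s) inferInstance) ⊔
    MeasurableSpace.generateFrom {A : Set Ω | P A = 0}
  mono' _ _ hst := by
    refine sup_le_sup (sup_le_sup le_rfl ?_) le_rfl
    exact iSup_mono fun r => iSup_mono' fun hr => ⟨hr.trans hst, le_rfl⟩
  le' t := by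
    refine sup_le (sup_le N.measurable_X₀.comap_le ?_) ?_
    · exact iSup₂_le fun s _ => (N.brownian.measurable s).comap_le
    · exact MeasurableSpace.generateFrom_le fun A hA => hP.out' A hA

/-! ### The Itô integral -/

/-- A simple process with values in the linear maps `ℝᵐ → ℝᵈ`: on `(t_k, t_{k+1}]`, for `k < n`,
it equals a bounded `ℱ_{t_k}`-measurable random variable `H_k`. -/
structure SimpleProcess [P.IsComplete] (N : Noise T d m P) where
  /-- the number of intervals -/
  n : ℕ
  /-- the partition points -/
  time : ℕ → TimeInterval T
  time_mono : Monotone time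
  /-- the values -/
  val : ℕ → Ω → (Rn m →L[ℝ] Rn d)
  val_measurable : ∀ k, Measurable[N.filtration (time k)] (val k)
  val_bounded : ∀ k, ∃ C : ℝ, ∀ ω, ‖val k ω‖ ≤ C

/-- The value of a simple process at time `t`. -/
def SimpleProcess.eval [P.IsComplete] {N : Noise T d m P} (H : SimpleProcess N)
    (t : TimeInterval T) (ω : Ω) : Rn m →L[ℝ] Rn d :=
  ∑ k ∈ Finset.range H.n,
    (Set.Ioc (H.time k) (H.time (k + 1))).indicator (fun _ => H.val k ω) t

/-- The stochastic integral `∫₀ᵗ H_s dB_s` of a simple process. -/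
def SimpleProcess.integral [P.IsComplete] {N : Noise T d m P} (H : SimpleProcess N)
    (t : TimeInterval T) (ω : Ω) : Rn d :=
  ∑ k ∈ Finset.range H.n,
    H.val k ω (N.B (min (H.time (k + 1)) t) ω - N.B (min (H.time k) t) ω)

/-- `Y` is (a version, with almost surely continuous paths, of) the Itô integral process
`∫₀ᵗ H_s dB_s`: there are simple processes `Hⁿ` with `∫₀ᵀ |Hⁿ_s - H_s|² ds → 0` in probability
and `∫₀ᵗ Hⁿ_s dB_s → Y_t` in probability for every `t`. -/
def IsItoIntegral [P.IsComplete] (N : Noise T d m P)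
    (H : TimeInterval T → Ω → (Rn m →L[ℝ] Rn d)) (Y : TimeInterval T → Ω → Rn d) : Prop :=
  (∀ᵐ ω ∂P, Continuous fun t => Y t ω) ∧
  ∃ S : ℕ → SimpleProcess N,
    (∀ ε : ℝ≥0∞, 0 < ε →
      Tendsto (fun n => P {ω | ε ≤
          ∫⁻ s, ENNReal.ofReal (‖(S n).eval s ω - H s ω‖ ^ 2) ∂(timeMeasure T)})
        atTop (𝓝 0)) ∧
    ∀ t, TendstoInMeasure P (fun n => (S n).integral t) atTop (Y t)

/-! ### Controls and the controlled diffusion -/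

/-- The class of controls: `U`-valued adapted (and jointly measurable) processes
with `E ∫₀ᵀ |u_t|² dt < ∞`. -/
structure IsControl [P.IsComplete] (N : Noise T d m P) {U : Set (Rn d₁)}
    (u : TimeInterval T → Ω → U) : Prop where
  measurable : Measurable fun p : TimeInterval T × Ω => u p.1 p.2
  adapted : Adapted N.filtration u
  sq_integrable : ∫⁻ ω, ∫⁻ t, ‖(u t ω : Rn d₁)‖ₑ ^ 2 ∂(timeMeasure T) ∂P < ∞

/-- The coefficients `b` and `σ` of the controlled diffusion with control set `U`. The matrix
`σ(t,x,u)` is regarded as a linear map `ℝᵐ → ℝᵈ`. -/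
structure Coefficients (T : ℝ≥0) (d m : ℕ) {d₁ : ℕ} (U : Set (Rn d₁)) where
  /-- the drift -/
  b : TimeInterval T → Rn d → U → Rn d
  /-- the diffusion coefficient -/
  σ : TimeInterval T → Rn d → U → (Rn m →L[ℝ] Rn d)

variable {U : Set (Rn d₁)}

/-- `φ` is Lipschitz in `x` with constant `C₀`, has modulus of continuity `ρ` in `u`, and
satisfies `|φ(t,0,0)| ≤ C₀`. -/
def RegularCoefficient {F : Type*} [NormedAddCommGroup F] (h0 : (0 : Rn d₁) ∈ U)
    (C₀ : ℝ) (ρ : ℝ≥0 → ℝ≥0) (φ : TimeInterval T → Rn d → U → F) : Prop :=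
  (∀ t x x' u u', ‖φ t x u - φ t x' u'‖ ≤
    C₀ * ‖x - x'‖ + (ρ ‖(u : Rn d₁) - (u' : Rn d₁)‖₊ : ℝ)) ∧
  ∀ t, ‖φ t 0 ⟨0, h0⟩‖ ≤ C₀

/-- Condition (A1): `b` and `σ` are Borel measurable, uniformly Lipschitz in `x`, with a common
modulus of continuity in `u`, and bounded at `x = 0`, `u = 0`. -/
def Coefficients.A1 (c : Coefficients T d m U) (h0 : (0 : Rn d₁) ∈ U) : Prop :=
  (Measurable fun p : TimeInterval T × Rn d × U => c.b p.1 p.2.1 p.2.2) ∧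
  (Measurable fun p : TimeInterval T × Rn d × U => c.σ p.1 p.2.1 p.2.2) ∧
  ∃ (C₀ : ℝ) (ρ : ℝ≥0 → ℝ≥0), 0 < C₀ ∧ ρ 0 = 0 ∧ Tendsto ρ (𝓝 0) (𝓝 0) ∧
    RegularCoefficient h0 C₀ ρ c.b ∧ RegularCoefficient h0 C₀ ρ c.σ

/-- `X` solves `dX_t = b(t,X_t,u_t) dt + σ(t,X_t,u_t) dB_t` on `[0, T]` with initial state `X₀`,
and `E sup_t |X_t|² < ∞`. -/
structure IsStateProcess [P.IsComplete] (N : Noise T d m P) (c : Coefficients T d m U)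
    (u : TimeInterval T → Ω → U) (X : TimeInterval T → Ω → Rn d) : Prop where
  adapted : Adapted N.filtration X
  continuous_paths : ∀ ω, Continuous fun t => X t ω
  drift_integrable : ∀ᵐ ω ∂P, Integrable (fun t => c.b t (X t ω) (u t ω)) (timeMeasure T)
  equation : ∃ Y : TimeInterval T → Ω → Rn d,
    IsItoIntegral N (fun t ω => c.σ t (X t ω) (u t ω)) Y ∧
    ∀ᵐ ω ∂P, ∀ t, X t ω =
      N.X₀ ω + (∫ s in Set.Iic t, c.b s (X s ω) (u s ω) ∂(timeMeasure T)) + Y t ω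
  sq_integrable_sup : ∫⁻ ω, ⨆ t, ‖X t ω‖ₑ ^ 2 ∂P < ∞

open scoped Classical in
/-- The state process `Xᵘ`: the solution of the controlled equation (unique up to
indistinguishability under (A1)). The value `0` when there is no solution is never used. -/
def stateProcess [P.IsComplete] (N : Noise T d m P) (c : Coefficients T d m U)
    (u : TimeInterval T → Ω → U) : TimeInterval T → Ω → Rn d :=
  if h : ∃ X, IsStateProcess N c u X then h.choose else fun _ _ => 0

/-! ### The forward problem -/

open scoped Classical in
/-- The cost `J(u; f, g) = E[∫₀ᵀ f(t, Xᵘ_t, u_t) dt + g(Xᵘ_T)]`, as an extended real number;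
it is `+∞` for a control without a state process. -/
def J [P.IsComplete] (N : Noise T d m P) (c : Coefficients T d m U)
    (u : TimeInterval T → Ω → U) (f : TimeInterval T × Rn d × U → ℝ) (g : Rn d → ℝ) : EReal :=
  if ∃ X, IsStateProcess N c u X then
    extIntegral P fun ω =>
      extIntegral (timeMeasure T) (fun t => (f (t, stateProcess N c u t ω, u t ω) : EReal)) +
        (g (stateProcess N c u (terminalTime T) ω) : EReal)
  else ⊤

/-- The value `J*(f, g) = inf_u J(u; f, g)` of the forward problem. -/
def Jstar [P.IsComplete] (N : Noise T d m P) (c : Coefficients T d m U)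
    (f : TimeInterval T × Rn d × U → ℝ) (g : Rn d → ℝ) : EReal :=
  ⨅ (u : TimeInterval T → Ω → U) (_ : IsControl N u), J N c u f g

/-- `u` is an optimal policy for the forward problem: a control with finite cost that attains
the infimum. -/
def IsOptimal [P.IsComplete] (N : Noise T d m P) (c : Coefficients T d m U)
    (u : TimeInterval T → Ω → U) (f : TimeInterval T × Rn d × U → ℝ) (g : Rn d → ℝ) : Prop :=
  IsControl N u ∧ J N c u f g = Jstar N c f g ∧ J N c u f g ≠ ⊤ ∧ J N c u f g ≠ ⊥

/-! ### The inverse problem -/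

/-- The marginal `μ̃_T(dx) = μ_T(dx × U)`. -/
def terminalMarginal (μ : TimeInterval T → Measure (Rn d × U)) : Measure (Rn d) :=
  (μ (terminalTime T)).map Prod.fst

/-- `∫₀ᵀ ∫ f(t,x,u) μ_t(dx du) dt`: the double integral of the positive part of `f` minus that of
the negative part. -/
def runningPairing (μ : TimeInterval T → Measure (Rn d × U))
    (f : TimeInterval T × Rn d × U → ℝ) : EReal :=
  upperAdd ((∫⁻ t, ∫⁻ z, ENNReal.ofReal (f (t, z)) ∂(μ t) ∂(timeMeasure T) : ℝ≥0∞) : EReal)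
    (-((∫⁻ t, ∫⁻ z, ENNReal.ofReal (-f (t, z)) ∂(μ t) ∂(timeMeasure T) : ℝ≥0∞) : EReal))

/-- The suboptimality gap
`V(f, g) = ∫₀ᵀ ⟨f(t,·,·), μ_t⟩ dt + ⟨g, μ̃_T⟩ - J*(f, g)` of the family `μ`, as an extended real
number. -/
def V [P.IsComplete] (N : Noise T d m P) (c : Coefficients T d m U)
    (μ : TimeInterval T → Measure (Rn d × U))
    (f : TimeInterval T × Rn d × U → ℝ) (g : Rn d → ℝ) : EReal :=
  upperAdd
    (upperAdd (runningPairing μ f) (extIntegral (terminalMarginal μ) fun x => (g x : EReal)))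
    (-Jstar N c f g)

end Noise

end

end InverseControl

open InverseControl

namespace InverseControl

/-! ### Arithmetic of differences with `∞ - ∞ = +∞`. -/

section ExtendedReals

/-! Since `μ t` is the law of the optimal state-control pair, the first two terms of `V` should be
the cost of `ustar`. Then `V` is the cost of one admissible control minus the infimum over all of
them: nonnegative for every pair in `D`, and zero where `ustar` is optimal. The difficulty is the
order of subtraction: `J` subtracts the negative part path by path before taking the expectation,
whereas `V` integrates positive and negative parts separately. If the positive parts have finite
integrals, both orders agree (`J_eq_pairing`); otherwise the convention `∞ - ∞ = +∞` makes `V` equal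
`⊤`, so `V_nonneg` holds anyway. The comparison is made through sums in `ℝ≥0∞`, where no subtraction
occurs. -/

theorem upperAdd_top_left (b : EReal) : upperAdd ⊤ b = ⊤ := by
  simp [upperAdd]

theorem upperAdd_top_right (a : EReal) : upperAdd a ⊤ = ⊤ := by
  simp [upperAdd]

theorem upperAdd_eq_add {a b : EReal} (ha : a ≠ ⊤) (hb : b ≠ ⊤) : upperAdd a b = a + b := by
  unfold upperAdd
  rw [EReal.neg_add (Or.inl (by simpa using ha)) (Or.inr (by simpa using hb)), neg_neg,
    sub_eq_add_neg, neg_neg]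

theorem neg_coe_ennreal_ne_top (b : ℝ≥0∞) : -(b : EReal) ≠ ⊤ := by
  simp [EReal.neg_eq_top_iff]

/-- The difference of two extended nonnegative reals is `+∞` as soon as the first one is. -/
theorem upperAdd_coe_neg_eq_top_iff {a b : ℝ≥0∞} :
    upperAdd (a : EReal) (-(b : EReal)) = ⊤ ↔ a = ∞ := by
  refine ⟨fun h => ?_, fun h => by simp [h, upperAdd_top_left]⟩
  by_contra ha
  rw [upperAdd_eq_add (by simpa using ha) (neg_coe_ennreal_ne_top b)] at h
  exact EReal.add_ne_top (by simpa using ha) (neg_coe_ennreal_ne_top b) h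

/-- The positive and negative parts of `a - b + r` are balanced against those of its terms. -/
theorem toENNReal_add_eq_of_upperAdd {a b : ℝ≥0∞} (ha : a ≠ ∞) (r : ℝ) :
    (upperAdd (a : EReal) (-(b : EReal)) + (r : EReal)).toENNReal + b + ENNReal.ofReal (-r) =
      (-(upperAdd (a : EReal) (-(b : EReal)) + (r : EReal))).toENNReal + a +
        ENNReal.ofReal r := by
  rw [upperAdd_eq_add (by simpa using ha) (neg_coe_ennreal_ne_top b)]
  lift a to ℝ≥0 using ha
  induction b with
  -- Both sides are `∞`: the left through `b`, the right because the difference is `⊥`.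
  | top => simp
  | coe b =>
    have h : ((a : ℝ≥0∞) : EReal) + -((b : ℝ≥0∞) : EReal) + (r : EReal) =
        (((a : ℝ) - b + r : ℝ) : EReal) := by
      rw [sub_eq_add_neg]; norm_cast
    rw [h, ← EReal.coe_neg, EReal.toENNReal_of_ne_top (EReal.coe_ne_top _),
      EReal.toENNReal_of_ne_top (EReal.coe_ne_top _), EReal.toReal_coe, EReal.toReal_coe,
      ← ENNReal.toReal_eq_toReal_iff' (by simp) (by simp)]
    have ht (x : ℝ) : (ENNReal.ofReal x).toReal = max x 0 := ENNReal.toReal_ofReal'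
    rw [ENNReal.toReal_add (by simp) (by simp), ENNReal.toReal_add (by simp) (by simp),
      ENNReal.toReal_add (by simp) (by simp), ENNReal.toReal_add (by simp) (by simp),
      ht, ht, ht, ht, ENNReal.coe_toReal, ENNReal.coe_toReal]
    have h₁ := max_zero_sub_eq_self ((a : ℝ) - b + r)
    have h₂ := max_zero_sub_eq_self r
    linarith

/-- Dominates the positive part of the cost along a path, so that its expectation is finite once the
positive parts of both costs are integrable. -/
theorem toENNReal_upperAdd_le (a b : ℝ≥0∞) (r : ℝ) :
    (upperAdd (a : EReal) (-(b : EReal)) + (r : EReal)).toENNReal ≤ a + ENNReal.ofReal r := by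
  by_cases ha : a = ∞
  · simp [ha]
  rw [upperAdd_eq_add (by simpa using ha) (neg_coe_ennreal_ne_top b)]
  refine (EReal.toENNReal_add_le).trans (add_le_add ?_ ?_)
  · refine (EReal.toENNReal_le_toENNReal (y := (a : EReal)) ?_).trans (by simp)
    exact (add_le_add_right (EReal.neg_le_zero.2 (EReal.coe_ennreal_nonneg b)) _).trans (by simp)
  · rw [EReal.toENNReal_of_ne_top (EReal.coe_ne_top _), EReal.toReal_coe]

/-- Balanced positive and negative parts have equal differences. -/
theorem upperAdd_eq_of_balance {p q a b x y : ℝ≥0∞} (hp : p ≠ ∞) (ha : a ≠ ∞) (hx : x ≠ ∞)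
    (h : p + b + y = q + a + x) :
    upperAdd (p : EReal) (-(q : EReal)) =
      upperAdd (upperAdd (a : EReal) (-(b : EReal))) (upperAdd (x : EReal) (-(y : EReal))) := by
  have hne {s t : ℝ≥0∞} (hs : s ≠ ∞) : upperAdd (s : EReal) (-(t : EReal)) = s + -(t : EReal) :=
    upperAdd_eq_add (by simpa using hs) (neg_coe_ennreal_ne_top t)
  rw [upperAdd_eq_add (a := upperAdd (a : EReal) _) (by rwa [Ne, upperAdd_coe_neg_eq_top_iff])
    (by rwa [Ne, upperAdd_coe_neg_eq_top_iff]), hne hp, hne ha, hne hx]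
  lift p to ℝ≥0 using hp
  lift a to ℝ≥0 using ha
  lift x to ℝ≥0 using hx
  induction q with
  | top =>
    -- As `p` is finite, the infinite right side of the balance forces `b` or `y` to be infinite,
    -- and both differences are then `⊥`.
    have : b = ∞ ∨ y = ∞ := by simpa [ENNReal.add_eq_top] using h
    rcases this with rfl | rfl <;> simp
  | coe q =>
    have hfin : (p : ℝ≥0∞) + b + y ≠ ∞ := by rw [h]; simp
    have hb : b ≠ ∞ := by rintro rfl; simp at hfin
    have hy : y ≠ ∞ := by rintro rfl; simp at hfin
    lift b to ℝ≥0 using hb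
    lift y to ℝ≥0 using hy
    have h' : (p : ℝ) + b + y = q + a + x := by exact_mod_cast h
    have h'' : (p : ℝ) + -q = a + -b + (x + -y) := by linarith
    simp only [EReal.coe_nnreal_eq_coe_real, ← EReal.coe_neg, ← EReal.coe_add]
    exact congrArg _ h''

theorem upperAdd_neg_nonneg {a b : EReal} (h : b ≤ a) : 0 ≤ upperAdd a (-b) := by
  by_cases ha : a = ⊤
  · simp [ha, upperAdd_top_left]
  by_cases hb : b = ⊥
  · simp [hb, upperAdd_top_right]
  rw [upperAdd_eq_add ha (by simpa [EReal.neg_eq_top_iff] using hb), ← sub_eq_add_neg]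
  exact (EReal.sub_nonneg (Or.inl ha) (Or.inr hb)).2 h

end ExtendedReals

/-! ### Cost of a control as a pairing with its laws. -/

section Problem

variable {Ω : Type*} [MeasurableSpace Ω] {T : ℝ≥0} {d d₁ m : ℕ} {P : Measure Ω}
  {U : Set (Rn d₁)}

theorem extIntegral_coe {α : Type*} [MeasurableSpace α] (ν : Measure α) (h : α → ℝ) :
    extIntegral ν (fun a => (h a : EReal)) =
      upperAdd ((∫⁻ a, ENNReal.ofReal (h a) ∂ν : ℝ≥0∞) : EReal)
        (-((∫⁻ a, ENNReal.ofReal (-h a) ∂ν : ℝ≥0∞) : EReal)) := by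
  have hc (x : ℝ) : (x : EReal).toENNReal = ENNReal.ofReal x := by
    rw [EReal.toENNReal_of_ne_top (EReal.coe_ne_top _), EReal.toReal_coe]
  simp_rw [extIntegral, ← EReal.coe_neg, hc]

/-- Supplies the s-finiteness that Tonelli's theorem requires. -/
instance isFiniteMeasure_timeMeasure : IsFiniteMeasure (timeMeasure T) := by
  refine ⟨?_⟩
  rw [timeMeasure, (MeasurableEmbedding.subtype_coe measurableSet_Icc).comap_apply]
  exact (measure_mono (Set.image_subset_iff.2 fun t _ => t.2)).trans_lt
    (measure_Icc_lt_top (μ := volume) (a := (0 : ℝ)) (b := (T : ℝ)))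

/-- Continuity in time and measurability in `ω` at each fixed time give joint measurability. -/
theorem IsStateProcess.measurable_uncurry [P.IsComplete] {N : Noise T d m P}
    {c : Coefficients T d m U} {u : TimeInterval T → Ω → U} {X : TimeInterval T → Ω → Rn d}
    (hX : IsStateProcess N c u X) : Measurable fun p : TimeInterval T × Ω => X p.1 p.2 :=
  measurable_uncurry_of_continuous_of_measurable hX.continuous_paths
    fun t => (hX.adapted t).mono (N.filtration.le t) le_rfl

theorem isStateProcess_stateProcess [P.IsComplete] {N : Noise T d m P}
    {c : Coefficients T d m U} {u : TimeInterval T → Ω → U} (h : ∃ X, IsStateProcess N c u X) :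
    IsStateProcess N c u (stateProcess N c u) := by
  rw [stateProcess, dif_pos h]
  exact h.choose_spec

/-- The cost of a control is the pairing of the costs with the laws `μ` of the controlled state,
provided that the positive parts of the costs are integrable. -/
theorem J_eq_pairing [SFinite P] [P.IsComplete] {N : Noise T d m P} {c : Coefficients T d m U}
    {u : TimeInterval T → Ω → U} (hu : IsControl N u) (hX : ∃ X, IsStateProcess N c u X)
    {μ : TimeInterval T → Measure (Rn d × U)}
    (hμ : ∀ t, HasLaw (fun ω => (stateProcess N c u t ω, u t ω)) (μ t) P)
    {f : TimeInterval T × Rn d × U → ℝ} {g : Rn d → ℝ} (hf : Measurable f) (hg : Measurable g)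
    (hf' : runningPairing μ f ≠ ⊤)
    (hg' : extIntegral (terminalMarginal μ) (fun x => (g x : EReal)) ≠ ⊤) :
    J N c u f g = upperAdd (runningPairing μ f)
      (extIntegral (terminalMarginal μ) fun x => (g x : EReal)) := by
  have hid : Measurable fun x : ℝ => x := measurable_id
  have hneg : Measurable fun x : ℝ => -x := measurable_neg
  have hXm := (isStateProcess_stateProcess hX).measurable_uncurry
  have hXT : Measurable (stateProcess N c u (terminalTime T)) := hXm.of_uncurry_left
  have hfm : Measurable fun p : TimeInterval T × Ω =>
      f (p.1, stateProcess N c u p.1 p.2, u p.1 p.2) :=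
    hf.comp (measurable_fst.prodMk (hXm.prodMk hu.measurable))
  -- Tonelli and change of variables; `φ` will be the identity for positive parts and negation for
  -- negative parts.
  have hrun (φ : ℝ → ℝ) (hφ : Measurable φ) :
      ∫⁻ t, ∫⁻ z, ENNReal.ofReal (φ (f (t, z))) ∂(μ t) ∂(timeMeasure T) =
        ∫⁻ ω, ∫⁻ t, ENNReal.ofReal (φ (f (t, stateProcess N c u t ω, u t ω)))
          ∂(timeMeasure T) ∂P := by
    rw [← lintegral_lintegral_swap ((hφ.comp hfm).ennreal_ofReal.aemeasurable)]
    refine lintegral_congr fun t => ?_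
    rw [← (hμ t).map_eq, lintegral_map' _ (hμ t).aemeasurable]
    exact (hφ.comp (hf.comp measurable_prodMk_left)).ennreal_ofReal.aemeasurable
  have hter (φ : ℝ → ℝ) (hφ : Measurable φ) :
      ∫⁻ x, ENNReal.ofReal (φ (g x)) ∂(terminalMarginal μ) =
        ∫⁻ ω, ENNReal.ofReal (φ (g (stateProcess N c u (terminalTime T) ω))) ∂P := by
    have hm : Measurable fun x => ENNReal.ofReal (φ (g x)) := (hφ.comp hg).ennreal_ofReal
    rw [terminalMarginal, lintegral_map hm measurable_fst, ← (hμ (terminalTime T)).map_eq,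
      lintegral_map' (f := fun z => ENNReal.ofReal (φ (g z.1)))
        (hm.comp measurable_fst).aemeasurable (hμ (terminalTime T)).aemeasurable]
  have hmeas (φ : ℝ → ℝ) (hφ : Measurable φ) : Measurable fun ω =>
      ∫⁻ t, ENNReal.ofReal (φ (f (t, stateProcess N c u t ω, u t ω))) ∂(timeMeasure T) :=
    Measurable.lintegral_prod_left' (hφ.comp hfm).ennreal_ofReal
  have hgm (φ : ℝ → ℝ) (hφ : Measurable φ) : Measurable fun ω =>
      ENNReal.ofReal (φ (g (stateProcess N c u (terminalTime T) ω))) :=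
    (hφ.comp (hg.comp hXT)).ennreal_ofReal
  rw [runningPairing, Ne, upperAdd_coe_neg_eq_top_iff] at hf'
  rw [extIntegral_coe, Ne, upperAdd_coe_neg_eq_top_iff] at hg'
  rw [J, if_pos hX, extIntegral_coe, runningPairing, extIntegral]
  simp_rw [extIntegral_coe]
  refine upperAdd_eq_of_balance ?_ hf' hg' ?_
  · refine ((lintegral_mono fun ω => toENNReal_upperAdd_le _ _ _).trans_lt ?_).ne
    rw [lintegral_add_right _ (hgm _ hid), ← hrun _ hid,
      ← hter _ hid]
    exact ENNReal.add_lt_top.2 ⟨lt_top_iff_ne_top.2 hf', lt_top_iff_ne_top.2 hg'⟩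
  · have hfin := hf'
    rw [hrun _ hid] at hfin
    rw [hrun _ hid, hrun _ hneg,
      hter _ hid, hter _ hneg,
      ← lintegral_add_right _ (hmeas _ hneg),
      ← lintegral_add_right _ (hgm _ hneg),
      ← lintegral_add_right _ (hmeas _ hid),
      ← lintegral_add_right _ (hgm _ hid)]
    refine lintegral_congr_ae ?_
    -- Almost every path has a finite positive running cost, since its expectation is finite; there
    -- the pathwise balance applies.
    filter_upwards [ae_lt_top (hmeas _ hid) hfin] with ω hω
    exact toENNReal_add_eq_of_upperAdd hω.ne _

/-- The gap of the laws of a controlled state is nonnegative. -/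
theorem V_nonneg [SFinite P] [P.IsComplete] {N : Noise T d m P} {c : Coefficients T d m U}
    {u : TimeInterval T → Ω → U} (hu : IsControl N u) (hX : ∃ X, IsStateProcess N c u X)
    {μ : TimeInterval T → Measure (Rn d × U)}
    (hμ : ∀ t, HasLaw (fun ω => (stateProcess N c u t ω, u t ω)) (μ t) P)
    {f : TimeInterval T × Rn d × U → ℝ} {g : Rn d → ℝ} (hf : Measurable f) (hg : Measurable g) :
    0 ≤ V N c μ f g := by
  refine upperAdd_neg_nonneg ?_
  by_cases hf' : runningPairing μ f = ⊤
  · simp [hf', upperAdd_top_left]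
  by_cases hg' : extIntegral (terminalMarginal μ) (fun x => (g x : EReal)) = ⊤
  · simp [hg', upperAdd_top_right]
  rw [← J_eq_pairing hu hX hμ hf hg hf' hg']
  exact iInf₂_le u hu

end Problem

end InverseControl

theorem mainTheorem4 {Ω : Type*} [MeasurableSpace Ω] (P : Measure Ω) [IsProbabilityMeasure P]
    [P.IsComplete] {T : ℝ≥0} (hT : 0 < T) {d d₁ m : ℕ}
    (U : Set (Rn d₁)) (hU : IsClosed U) (hU0 : (0 : Rn d₁) ∈ U)
    (N : Noise T d m P) (c : Coefficients T d m U)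
    (hA1 : c.A1 hU0)
    (D : Set ((TimeInterval T × Rn d × U → ℝ) ×
      (Rn d → ℝ)))
    (hD : ∀ p ∈ D, Measurable p.1 ∧ Measurable p.2)
    (μ : TimeInterval T → Measure (Rn d × U))
    (ustar : TimeInterval T → Ω → U)
    (fstar : TimeInterval T × Rn d × U → ℝ)
    (gstar : Rn d → ℝ) (hmem : (fstar, gstar) ∈ D)
    (hopt : IsOptimal N c ustar fstar gstar)
    (hμ : ∀ t, HasLaw (fun ω => (stateProcess N c ustar t ω, ustar t ω)) (μ t) P)
    (hf : ∫⁻ t, ∫⁻ z, ‖fstar (t, z)‖ₑ ∂(μ t) ∂(timeMeasure T) < ∞)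
    (hg : Integrable gstar (terminalMarginal μ)) :
    IsMinOn (fun p => V N c μ p.1 p.2) D (fstar, gstar) ∧
      V N c μ fstar gstar = (⨅ p ∈ D, V N c μ p.1 p.2) ∧
      (⨅ p ∈ D, V N c μ p.1 p.2) = 0 := by
  obtain ⟨hu, hJ, hJtop, hJbot⟩ := hopt
  -- Finiteness of the optimal cost rules out the default value `⊤`, so `stateProcess` is a genuine
  -- solution here.
  have hX : ∃ X, IsStateProcess N c ustar X := by
    by_contra h
    exact hJtop (by rw [J, if_neg h])
  have hnonneg : ∀ p ∈ D, 0 ≤ V N c μ p.1 p.2 := fun p hp =>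
    V_nonneg hu hX hμ (hD p hp).1 (hD p hp).2
  have hf' : runningPairing μ fstar ≠ ⊤ := by
    rw [runningPairing, Ne, upperAdd_coe_neg_eq_top_iff]
    refine ((lintegral_mono fun t => lintegral_mono fun z => ?_).trans_lt hf).ne
    exact Real.ofReal_le_enorm _
  have hg' : extIntegral (terminalMarginal μ) (fun x => (gstar x : EReal)) ≠ ⊤ := by
    rw [extIntegral_coe, Ne, upperAdd_coe_neg_eq_top_iff]
    exact ((lintegral_mono fun x => Real.ofReal_le_enorm _).trans_lt hg.2).ne
  have hzero : V N c μ fstar gstar = 0 := by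
    -- The gap becomes the optimal cost minus itself, an ordinary difference because that cost is
    -- finite.
    rw [V, ← J_eq_pairing hu hX hμ (hD _ hmem).1 (hD _ hmem).2 hf' hg', ← hJ,
      upperAdd_eq_add hJtop (by simpa [EReal.neg_eq_top_iff] using hJbot), ← sub_eq_add_neg,
      EReal.sub_self hJtop hJbot]
  have hinf : (⨅ p ∈ D, V N c μ p.1 p.2) = 0 :=
    le_antisymm ((iInf₂_le (fstar, gstar) hmem).trans_eq hzero) (le_iInf₂ hnonneg)
  refine ⟨fun p hp => ?_, hzero.trans hinf.symm, hinf⟩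
  change V N c μ fstar gstar ≤ V N c μ p.1 p.2
  exact hzero.trans_le (hnonneg p hp)
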